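/- Let $\mathbb{H}$ denote the real quaternions with their usual conjugation and modulus, and let $c=(c_n)_{n\in\mathbb{Z}}\subset\mathbb{H}$ be a non-trivial positive definite sequence, i.e. for every $n\ge 0$ the Toeplitz matrix $T_n(c)=[c_{j-k}]_{k,j=0}^n$ satisfies $\xi^*T_n(c)\xi\in(0,\infty)$ for all nonzero column vectors $\xi\in\mathbb{H}^{n+1}$. Let $\mathbb{H}[p]^L$ be the space of polynomials $\sum_k p^k\varphi_k$ and $\mathbb{H}[p]^R$ the space of polynomials $\sum_k\varphi_kp^k$, with $\varphi_k\in\mathbb{H}$. Put $$\langle\varphi,\psi\rangle_R=\sum_{k,\ell}\overline{\psi_\ell}\,c_{k-\ell}\,\varphi_k\quad(\varphi,\psi\in\mathbb{H}[p]^L),\qquad \langle\varphi,\psi\rangle_L=\sum_{k,\ell}\varphi_k\,c_{k-\ell}\,\overline{\psi_\ell}\quad(\varphi,\psi\in\mathbb{H}[p]^R).$$ The right-orthonormal polynomials $(\psi_n^R)_{n\ge0}\subset\mathbb{H}[p]^L$ are obtained from $1,p,p^2,\dots$ by Gram--Schmidt with respect to $\langle\cdot,\cdot\rangle_R$ with scalars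 acting on the right, and the left-orthonormal polynomials $(\psi_n^L)_{n\ge0}\subset\mathbb{H}[p]^R$ are obtained from $1,p,p^2,\dots$ by Gram--Schmidt with respect to $\langle\cdot,\cdot\rangle_L$ with scalars acting on the left. The reverse of $\varphi=\sum_{k=0}^m p^k\varphi_k\in\mathbb{H}[p]^L$ of degree $m$ is $\varphi^{\#}(p)=\sum_{k=0}^m\overline{\varphi_k}\,p^{m-k}\in\mathbb{H}[p]^R$ (that is, $\overline{\varphi(1/\overline p)}\,p^m$ for $p\ne0$), and the reverse of $\psi=\sum_{k=0}^m\psi_kp^k\in\mathbb{H}[p]^R$ of degree $m$ is $\psi^{\#}(p)=\sum_{k=0}^m p^{m-k}\,\overline{\psi_k}\in\mathbb{H}[p]^L$ (that is, $p^m\,\overline{\psi(1/\overline p)}$ for $p\neq 0$). Then for every integer $n\ge0$ and every $p\in\mathbb{H}$ with $|p|\ne1$, $$\begin{aligned}\sum_{\ell=0}^n\Big(|\psi_\ell^L(p)|^2+|\psi_\ell^R(p)|^2\Big)&=\frac{|\psi_{n+1}^{L,\#}(p)|^2+|\psi_{n+1}^{R,\#}(p)|^2-\big(|\psi_{n+1}^L(p)|^2+|\psi_{n+1}^R(p)|^2\big)}{1-|p|^2}\\&=\frac{|\psi_n^{L,\#}(p)|^2+|\psi_n^{R,\#}(p)|^2-|p|^2\big(|\psi_n^L(p)|^2+|\psi_n^R(p)|^2\big)}{1-|p|^2}.\end{aligned}$$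 -/

import Mathlib

open scoped Quaternion Polynomial Matrix

noncomputable section

namespace QuatOP

/-- The Toeplitz matrix `T_n(c) = [c_{j-k}]_{k,j=0}^n` of a bi-infinite quaternionic sequence. -/
def toeplitz (c : ℤ → ℍ[ℝ]) (n : ℕ) : Matrix (Fin (n + 1)) (Fin (n + 1)) ℍ[ℝ] :=
  Matrix.of fun k j => c ((j : ℤ) - (k : ℤ))

/-- A quaternionic matrix is positive definite if `ξ* A ξ` is a (strictly) positive real number
for every nonzero column vector `ξ`. -/
def IsPosDef {m : ℕ} (A : Matrix (Fin m) (Fin m) ℍ[ℝ]) : Prop :=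
  ∀ ξ : Fin m → ℍ[ℝ], ξ ≠ 0 → ∃ r : ℝ, 0 < r ∧ star ξ ⬝ᵥ (A *ᵥ ξ) = (r : ℍ[ℝ])

/-- Non-trivial positive definite sequences: all Toeplitz matrices are positive definite. -/
def IsNontrivialPosDef (c : ℤ → ℍ[ℝ]) : Prop :=
  ∀ n : ℕ, IsPosDef (toeplitz c n)

/-!
Both `ℍ[p]^L` (polynomials `∑ p^k φ_k`) and `ℍ[p]^R` (polynomials `∑ φ_k p^k`) are represented by
their coefficient sequences, as elements of Mathlib's `ℍ[ℝ][X]` (there `X` commutes with the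
coefficients); the two spaces differ in the way in which a polynomial is evaluated.
-/

/-- The value `∑ p^k φ_k` at `p` of the polynomial in `ℍ[p]^L` with coefficients `φ_k`. -/
def evalL (p : ℍ[ℝ]) (φ : ℍ[ℝ][X]) : ℍ[ℝ] := φ.sum fun k a => p ^ k * a

/-- The value `∑ φ_k p^k` at `p` of the polynomial in `ℍ[p]^R` with coefficients `φ_k`. -/
def evalR (p : ℍ[ℝ]) (φ : ℍ[ℝ][X]) : ℍ[ℝ] := φ.sum fun k a => a * p ^ k

/-- The form `⟨φ, ψ⟩_R = ∑_{k,ℓ} conj(ψ_ℓ) c_{k-ℓ} φ_k` on `ℍ[p]^L`, i.e. `ψ̂* T_N(c) φ̂` for the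
coefficient vectors `φ̂`, `ψ̂`. -/
def innerR (c : ℤ → ℍ[ℝ]) (φ ψ : ℍ[ℝ][X]) : ℍ[ℝ] :=
  φ.sum fun k a => ψ.sum fun l b => star b * c ((k : ℤ) - (l : ℤ)) * a

/-- The form `⟨φ, ψ⟩_L = ∑_{k,ℓ} φ_k c_{k-ℓ} conj(ψ_ℓ)` on `ℍ[p]^R`. -/
def innerL (c : ℤ → ℍ[ℝ]) (φ ψ : ℍ[ℝ][X]) : ℍ[ℝ] :=
  φ.sum fun k a => ψ.sum fun l b => a * c ((k : ℤ) - (l : ℤ)) * star b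

/-- The right-orthonormal polynomials `ψ_n^R ∈ ℍ[p]^L`: Gram–Schmidt applied to `1, p, p², …` for
`⟨·,·⟩_R`, with scalars acting on the right. -/
def psiR (c : ℤ → ℍ[ℝ]) (n : ℕ) : ℍ[ℝ][X] :=
  let P : ℍ[ℝ][X] := Polynomial.X ^ n -
    ∑ k : Fin n, psiR c k * Polynomial.C (innerR c (Polynomial.X ^ n) (psiR c k))
  (Real.sqrt (innerR c P P).re)⁻¹ • P
termination_by n
decreasing_by all_goals exact k.2

/-- The left-orthonormal polynomials `ψ_n^L ∈ ℍ[p]^R`: Gram–Schmidt applied to `1, p, p², …` for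
`⟨·,·⟩_L`, with scalars acting on the left. -/
def psiL (c : ℤ → ℍ[ℝ]) (n : ℕ) : ℍ[ℝ][X] :=
  let P : ℍ[ℝ][X] := Polynomial.X ^ n -
    ∑ k : Fin n, Polynomial.C (innerL c (Polynomial.X ^ n) (psiL c k)) * psiL c k
  (Real.sqrt (innerL c P P).re)⁻¹ • P
termination_by n
decreasing_by all_goals exact k.2

/-- The coefficients of the reverse polynomial: `φ_k` becomes `conj(φ_k)` in degree `deg φ - k`.
Reversal exchanges `ℍ[p]^L` and `ℍ[p]^R`; see `evalR_rev` and `evalL_rev`. -/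
def rev (φ : ℍ[ℝ][X]) : ℍ[ℝ][X] :=
  ∑ k ∈ Finset.range (φ.natDegree + 1), Polynomial.monomial (φ.natDegree - k) (star (φ.coeff k))

/-- For `φ ∈ ℍ[p]^L` of degree `n`, `φ^#(p) = conj(φ(1/conj p)) p^n`, in `ℍ[p]^R`. -/
theorem evalR_rev (φ : ℍ[ℝ][X]) (p : ℍ[ℝ]) (hp : p ≠ 0) :
    evalR p (rev φ) = star (evalL (star p)⁻¹ φ) * p ^ φ.natDegree := by
  have h1 : evalR p (rev φ) = (rev φ).eval p := by
    simp [evalR, Polynomial.eval_eq_sum]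
  rw [h1, rev, Polynomial.eval_finsetSum, evalL,
    Polynomial.sum_over_range _ (by simp), star_sum, Finset.sum_mul]
  refine Finset.sum_congr rfl fun k hk => ?_
  have hk' : k ≤ φ.natDegree := Nat.lt_succ_iff.mp (Finset.mem_range.mp hk)
  rw [Polynomial.eval_monomial, star_mul, star_pow, star_inv₀, star_star, mul_assoc,
    inv_pow, pow_sub₀ p hp hk', (Commute.pow_pow (Commute.refl p) _ _).inv_right₀.eq]

/-- For `ψ ∈ ℍ[p]^R` of degree `m`, `ψ^#(p) = p^m conj(ψ(1/conj p))`, in `ℍ[p]^L`. -/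
theorem evalL_rev (ψ : ℍ[ℝ][X]) (p : ℍ[ℝ]) (hp : p ≠ 0) :
    evalL p (rev ψ) = p ^ ψ.natDegree * star (evalR (star p)⁻¹ ψ) := by
  have hadd : ∀ (s : Finset ℕ) (f : ℕ → ℍ[ℝ][X]),
      evalL p (∑ k ∈ s, f k) = ∑ k ∈ s, evalL p (f k) := by
    intro s f
    classical
    induction s using Finset.induction_on with
    | empty => simp [evalL]
    | insert a s ha ih =>
      rw [Finset.sum_insert ha, Finset.sum_insert ha, ← ih, evalL, Polynomial.sum_add_index]
      · rfl
      · simp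
      · intro n a b; exact mul_add _ _ _
  rw [rev, hadd, evalR, Polynomial.sum_over_range _ (by simp), star_sum, Finset.mul_sum]
  refine Finset.sum_congr rfl fun k hk => ?_
  have hk' : k ≤ ψ.natDegree := Nat.lt_succ_iff.mp (Finset.mem_range.mp hk)
  rw [evalL, Polynomial.sum_monomial_index _ _ (by simp), star_mul, star_pow, star_inv₀,
    star_star, ← mul_assoc, inv_pow, pow_sub₀ p hp hk']

end QuatOP

end

namespace QuatOP
open Polynomial

/-! Write `č m = c (-m)`. Conjugating coefficients turns the left family of `c` into the right
family of `č` (`coeff_psiL`), and evaluation at `p` into evaluation at `star p`. So only the form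
`innerR` is needed, for `c` and for `č`.

Let `A`, `B` be the monic orthogonal polynomials of degree `n` for `c`, `č`, and `B^r` the
degree-`n` reflection of `B`. Toeplitz invariance under shift and reflection gives the Szegő
recursion `A' = X A - B^r α`, `B'^r = B^r - X A ᾱ` (`exists_szego`). Both families have the same
squared norm `N`, with `N' = (1 - |α|²) N`. With `a = p A(p)` and `b = B^r(p)`, the identity `|b - a
ᾱ|² - |a - b α|² = (1 - |α|²)(|b|² - |a|²)` therefore becomes, after normalization, a relation
without `α` (`christoffelDarboux_step`), and this telescopes (`christoffelDarboux_half`). The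
theorem is the sum of this half for `c` at `p` and for `č` at `star p`. -/

theorem innerR_eq_sum_range (c : ℤ → ℍ[ℝ]) {φ ψ : ℍ[ℝ][X]} {N : ℕ}
    (hφ : φ.natDegree < N) (hψ : ψ.natDegree < N) :
    innerR c φ ψ = ∑ k ∈ Finset.range N, ∑ l ∈ Finset.range N,
      star (ψ.coeff l) * c ((k : ℤ) - (l : ℤ)) * φ.coeff k := by
  rw [innerR, sum_over_range' _ (by simp [Polynomial.sum]) N hφ]
  refine Finset.sum_congr rfl fun k _ => ?_
  rw [sum_over_range' _ (by simp) N hψ]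

theorem innerL_eq_sum_range (c : ℤ → ℍ[ℝ]) {φ ψ : ℍ[ℝ][X]} {N : ℕ}
    (hφ : φ.natDegree < N) (hψ : ψ.natDegree < N) :
    innerL c φ ψ = ∑ k ∈ Finset.range N, ∑ l ∈ Finset.range N,
      φ.coeff k * c ((k : ℤ) - (l : ℤ)) * star (ψ.coeff l) := by
  rw [innerL, sum_over_range' _ (by simp [Polynomial.sum]) N hφ]
  refine Finset.sum_congr rfl fun k _ => ?_
  rw [sum_over_range' _ (by simp) N hψ]

theorem evalL_eq_sum_range (p : ℍ[ℝ]) {φ : ℍ[ℝ][X]} {N : ℕ} (hφ : φ.natDegree < N) :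
    evalL p φ = ∑ k ∈ Finset.range N, p ^ k * φ.coeff k := by
  rw [evalL, sum_over_range' _ (by simp) N hφ]

theorem evalR_eq_sum_range (p : ℍ[ℝ]) {φ : ℍ[ℝ][X]} {N : ℕ} (hφ : φ.natDegree < N) :
    evalR p φ = ∑ k ∈ Finset.range N, φ.coeff k * p ^ k := by
  rw [evalR, sum_over_range' _ (by simp) N hφ]

/-! ### Sesquilinearity -/

section Sesquilinear

variable (c : ℤ → ℍ[ℝ]) (φ φ' ψ ψ' : ℍ[ℝ][X]) (a : ℍ[ℝ])

theorem exists_natDegree_lt₂ : ∃ N, φ.natDegree < N ∧ ψ.natDegree < N :=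
  ⟨max φ.natDegree ψ.natDegree + 1, by omega, by omega⟩

theorem innerR_add_left : innerR c (φ + φ') ψ = innerR c φ ψ + innerR c φ' ψ := by
  unfold innerR
  rw [sum_add_index]
  · simp [Polynomial.sum]
  · intro k a b
    simp [mul_add, Polynomial.sum, Finset.sum_add_distrib]

theorem innerR_add_right : innerR c φ (ψ + ψ') = innerR c φ ψ + innerR c φ ψ' := by
  unfold innerR
  rw [← Polynomial.sum_add]
  congr 1
  ext1 k; ext1 a
  rw [sum_add_index]
  · simp
  · intro k a b
    simp [add_mul]

theorem innerR_mul_C_left : innerR c (φ * C a) ψ = innerR c φ ψ * a := by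
  obtain ⟨N, h1, h2⟩ := exists_natDegree_lt₂ φ ψ
  rw [innerR_eq_sum_range c h1 h2,
    innerR_eq_sum_range c ((natDegree_mul_C_le φ a).trans_lt h1) h2]
  simp [Finset.sum_mul, mul_assoc]

theorem innerR_mul_C_right : innerR c φ (ψ * C a) = star a * innerR c φ ψ := by
  obtain ⟨N, h1, h2⟩ := exists_natDegree_lt₂ φ ψ
  rw [innerR_eq_sum_range c h1 h2,
    innerR_eq_sum_range c h1 ((natDegree_mul_C_le ψ a).trans_lt h2)]
  simp [Finset.mul_sum, mul_assoc]

theorem innerR_sub_left : innerR c (φ - φ') ψ = innerR c φ ψ - innerR c φ' ψ := by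
  rw [eq_sub_iff_add_eq, ← innerR_add_left, sub_add_cancel]

theorem innerR_sub_right : innerR c φ (ψ - ψ') = innerR c φ ψ - innerR c φ ψ' := by
  rw [eq_sub_iff_add_eq, ← innerR_add_right, sub_add_cancel]

theorem innerR_sum_left {ι : Type*} (s : Finset ι) (f : ι → ℍ[ℝ][X]) :
    innerR c (∑ i ∈ s, f i) ψ = ∑ i ∈ s, innerR c (f i) ψ :=
  map_sum (AddMonoidHom.mk' (fun φ => innerR c φ ψ) fun a b => innerR_add_left c a b ψ) f s

theorem innerR_sum_right {ι : Type*} (s : Finset ι) (f : ι → ℍ[ℝ][X]) :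
    innerR c φ (∑ i ∈ s, f i) = ∑ i ∈ s, innerR c φ (f i) :=
  map_sum (AddMonoidHom.mk' (fun ψ => innerR c φ ψ) fun a b => innerR_add_right c φ a b) f s

/-- Toeplitz structure: `c` is only evaluated at the difference of the two degrees. -/
theorem innerR_X_mul : innerR c (X * φ) (X * ψ) = innerR c φ ψ := by
  obtain ⟨N, h1, h2⟩ := exists_natDegree_lt₂ φ ψ
  have hX : ∀ χ : ℍ[ℝ][X], χ.natDegree < N → (X * χ).natDegree < N + 1 := fun χ h => by
    have := natDegree_mul_le (p := X) (q := χ)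
    have := natDegree_X_le (R := ℍ[ℝ])
    omega
  rw [innerR_eq_sum_range c h1 h2, innerR_eq_sum_range c (hX φ h1) (hX ψ h2)]
  simp [Finset.sum_range_succ', coeff_X_mul]

/-- Expansion of `⟨φ, ψ⟩_R` along the coefficients of `ψ`. -/
theorem innerR_eq_sum_coeff_mul {N : ℕ} (hψ : ψ.natDegree < N) :
    innerR c φ ψ = ∑ l ∈ Finset.range N, star (ψ.coeff l) * innerR c φ (X ^ l) := by
  conv_lhs => rw [as_sum_range_C_mul_X_pow' ψ hψ]
  rw [innerR_sum_right]
  refine Finset.sum_congr rfl fun l _ => ?_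
  rw [← X_pow_mul, innerR_mul_C_right]

end Sesquilinear

/-! ### Reflection -/

theorem natDegree_reflect_le' {N : ℕ} {φ : ℍ[ℝ][X]} (h : φ.natDegree ≤ N) :
    (reflect N φ).natDegree ≤ N :=
  (natDegree_reflect_le).trans (max_le le_rfl h)

theorem coeff_reflect_of_le {N k : ℕ} (φ : ℍ[ℝ][X]) (h : k ≤ N) :
    (reflect N φ).coeff k = φ.coeff (N - k) := by
  rw [coeff_reflect, revAt_le h]

theorem reflect_X_mul {n : ℕ} {φ : ℍ[ℝ][X]} (hφ : φ.natDegree ≤ n) :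
    reflect (n + 1) (X * φ) = reflect n φ := by
  rw [add_comm, reflect_mul _ _ natDegree_X_le hφ, reflect_one_X, one_mul]

theorem reflect_succ {n : ℕ} {φ : ℍ[ℝ][X]} (hφ : φ.natDegree ≤ n) :
    reflect (n + 1) φ = X * reflect n φ := by
  have := reflect_mul (1 : ℍ[ℝ][X]) φ (F := 1) (by simp) hφ
  rwa [one_mul, reflect_one, pow_one, add_comm] at this

theorem reflect_mul_C (φ : ℍ[ℝ][X]) (a : ℍ[ℝ]) (N : ℕ) :
    reflect N (φ * C a) = reflect N φ * C a := by
  ext1 k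
  simp only [coeff_reflect, coeff_mul_C]

theorem reflect_sub' (φ ψ : ℍ[ℝ][X]) (N : ℕ) :
    reflect N (φ - ψ) = reflect N φ - reflect N ψ := by
  ext1 k
  simp only [coeff_reflect, coeff_sub]

/-- Reflection turns the form of `c` into the form of `n ↦ c (-n)`. -/
theorem innerR_reflect (c : ℤ → ℍ[ℝ]) {φ ψ : ℍ[ℝ][X]} {N : ℕ}
    (hφ : φ.natDegree ≤ N) (hψ : ψ.natDegree ≤ N) :
    innerR c (reflect N φ) (reflect N ψ) = innerR (fun m => c (-m)) φ ψ := by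
  rw [innerR_eq_sum_range _ (Nat.lt_succ_of_le hφ) (Nat.lt_succ_of_le hψ),
    innerR_eq_sum_range _ (Nat.lt_succ_of_le (natDegree_reflect_le' hφ))
      (Nat.lt_succ_of_le (natDegree_reflect_le' hψ)), ← Finset.sum_range_reflect]
  refine Finset.sum_congr rfl fun k hk => ?_
  rw [← Finset.sum_range_reflect]
  refine Finset.sum_congr rfl fun l hl => ?_
  have hk' : k ≤ N := Nat.lt_succ_iff.mp (Finset.mem_range.mp hk)
  have hl' : l ≤ N := Nat.lt_succ_iff.mp (Finset.mem_range.mp hl)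
  have hk2 : N.succ - 1 - k = N - k := by omega
  have hl2 : N.succ - 1 - l = N - l := by omega
  rw [hk2, hl2, coeff_reflect_of_le _ (Nat.sub_le _ _), coeff_reflect_of_le _ (Nat.sub_le _ _),
    Nat.sub_sub_self hk', Nat.sub_sub_self hl']
  congr 3
  push_cast [hk', hl']
  ring

/-! ### Positivity and symmetry -/

section PosDef

variable {c : ℤ → ℍ[ℝ]} (hc : IsNontrivialPosDef c)
include hc

theorem exists_innerR_self {φ : ℍ[ℝ][X]} (hφ : φ ≠ 0) :
    ∃ r : ℝ, 0 < r ∧ innerR c φ φ = (r : ℍ[ℝ]) := by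
  set n := φ.natDegree with hn
  obtain ⟨r, hr, h⟩ := hc n (fun k => φ.coeff k) (fun h0 => hφ <| by
    have := congrFun h0 (Fin.last n)
    simpa [hn] using this)
  refine ⟨r, hr, ?_⟩
  rw [← h, innerR_eq_sum_range c (Nat.lt_succ_self _) (Nat.lt_succ_self _), Finset.sum_comm,
    Finset.sum_range]
  simp only [dotProduct, Matrix.mulVec, toeplitz, Matrix.of_apply, Finset.sum_range,
    Finset.mul_sum, Pi.star_apply, mul_assoc]
  rfl

theorem innerR_self_re_pos {φ : ℍ[ℝ][X]} (hφ : φ ≠ 0) : 0 < (innerR c φ φ).re := by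
  obtain ⟨r, hr, h⟩ := exists_innerR_self hc hφ
  simpa [h] using hr

theorem innerR_self_eq_coe_re {φ : ℍ[ℝ][X]} (hφ : φ ≠ 0) :
    innerR c φ φ = ((innerR c φ φ).re : ℍ[ℝ]) := by
  obtain ⟨r, hr, h⟩ := exists_innerR_self hc hφ
  simp [h]

/-- Polarization: the form is real on `1 + p^n a`. Taking `a = 1` makes the imaginary parts of `c n`
and `c (-n)` opposite; taking `a = i` makes their real parts equal. -/
theorem star_coeff_eq (m : ℤ) : star (c m) = c (-m) := by
  have hX : ∀ k l : ℕ, innerR c (X ^ k) (X ^ l) = c (k - l) := fun k l => by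
    rw [innerR, ← monomial_one_right_eq_X_pow, ← monomial_one_right_eq_X_pow,
      sum_monomial_index _ _ (by simp [Polynomial.sum]), sum_monomial_index _ _ (by simp)]
    simp
  have h0 : c 0 = ((c 0).re : ℍ[ℝ]) := by
    have := innerR_self_eq_coe_re hc (φ := X ^ 0) (by simp)
    rw [hX] at this
    simpa using this
  have key : ∀ (n : ℕ), n ≠ 0 → star (c n) = c (-n) := by
    intro n hn
    have hne : ∀ a : ℍ[ℝ], (X ^ 0 + X ^ n * C a : ℍ[ℝ][X]) ≠ 0 := fun a h => by
      have := congrArg (fun φ => coeff φ 0) h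
      simp [hn.symm, coeff_X_pow, mul_coeff_zero] at this
    have hexp : ∀ a : ℍ[ℝ], c 0 + c n * a + (star a * c (-n) + star a * c 0 * a) =
        ((innerR c (X ^ 0 + X ^ n * C a) (X ^ 0 + X ^ n * C a)).re : ℍ[ℝ]) := fun a => by
      rw [← innerR_self_eq_coe_re hc (hne a), innerR_add_right, innerR_add_left,
        innerR_add_left]
      simp only [innerR_mul_C_left, innerR_mul_C_right, hX]
      simp [mul_assoc]
    have h1 := hexp 1
    obtain ⟨i, hi0, hi1, hi2, hi3⟩ : ∃ i : ℍ[ℝ], i.re = 0 ∧ i.imI = 1 ∧ i.imJ = 0 ∧ i.imK = 0 :=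
      ⟨⟨0, 1, 0, 0⟩, rfl, rfl, rfl, rfl⟩
    have h2 := hexp i
    rw [h0] at h1 h2
    rw [Quaternion.ext_iff] at h1 h2 ⊢
    simp [hi0, hi1, hi2, hi3] at h1 h2 ⊢
    refine ⟨?_, ?_, ?_, ?_⟩ <;> linarith [h1.1, h1.2.1, h1.2.2, h2.1]
  obtain ⟨n, rfl | rfl⟩ := m.eq_nat_or_neg
  · rcases eq_or_ne n 0 with rfl | hn
    · have : c ((0 : ℕ) : ℤ) = ((c 0).re : ℍ[ℝ]) := by simpa using h0
      rw [this]; simpa using h0.symm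
    · exact key n hn
  · rcases eq_or_ne n 0 with rfl | hn
    · have : c (-((0 : ℕ) : ℤ)) = ((c 0).re : ℍ[ℝ]) := by simpa using h0
      rw [this]; simpa using h0.symm
    · rw [← key n hn, star_star, neg_neg]

theorem star_innerR (φ ψ : ℍ[ℝ][X]) : star (innerR c φ ψ) = innerR c ψ φ := by
  obtain ⟨N, h1, h2⟩ := exists_natDegree_lt₂ φ ψ
  rw [innerR_eq_sum_range c h1 h2, innerR_eq_sum_range c h2 h1, Finset.sum_comm]
  simp [star_sum, star_coeff_eq hc, mul_assoc]

/-- The Toeplitz matrix of `c (-m)` is that of `c` with rows and columns in reverse order. -/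
theorem IsNontrivialPosDef.comp_neg : IsNontrivialPosDef fun m => c (-m) := by
  intro n ξ hξ
  obtain ⟨r, hr, h⟩ := hc n (ξ ∘ Fin.rev) fun h0 => hξ <| by
    ext1 k
    simpa using congrFun h0 k.rev
  refine ⟨r, hr, ?_⟩
  rw [← h]
  simp only [dotProduct, Matrix.mulVec, toeplitz, Matrix.of_apply, Pi.star_apply]
  rw [← Equiv.sum_comp Fin.revPerm]
  refine Finset.sum_congr rfl fun k _ => ?_
  rw [← Equiv.sum_comp Fin.revPerm]
  simp only [Fin.revPerm_apply, Function.comp_apply]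
  congr 1
  refine Finset.sum_congr rfl fun l _ => ?_
  congr 2
  have := k.2
  have := l.2
  rw [Fin.val_rev, Fin.val_rev]
  omega

end PosDef


/-! ### Monic orthogonal polynomials -/

/-- `A` is the monic polynomial of degree `n` orthogonal to `1, p, …, p^(n-1)`. -/
structure IsMonicOrth (c : ℤ → ℍ[ℝ]) (n : ℕ) (A : ℍ[ℝ][X]) : Prop where
  natDegree_le : A.natDegree ≤ n
  coeff_eq_one : A.coeff n = 1
  innerR_X_pow : ∀ k < n, innerR c A (X ^ k) = 0

namespace IsMonicOrth

variable {c : ℤ → ℍ[ℝ]} {n : ℕ} {A : ℍ[ℝ][X]}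

theorem ne_zero (hA : IsMonicOrth c n A) : A ≠ 0 := fun h => by
  have := hA.coeff_eq_one
  simp [h] at this

theorem natDegree_eq (hA : IsMonicOrth c n A) : A.natDegree = n :=
  natDegree_eq_of_le_of_coeff_ne_zero hA.natDegree_le (by simp [hA.coeff_eq_one])

/-- The pairing with a polynomial of degree at most `n` only sees the coefficient of `p^n`. -/
theorem innerR_eq (hA : IsMonicOrth c n A) {ψ : ℍ[ℝ][X]} (hψ : ψ.natDegree ≤ n) :
    innerR c A ψ = star (ψ.coeff n) * innerR c A (X ^ n) := by
  rw [innerR_eq_sum_coeff_mul c A ψ (Nat.lt_succ_of_le hψ), Finset.sum_range_succ,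
    Finset.sum_eq_zero, zero_add]
  intro k hk
  rw [hA.innerR_X_pow k (Finset.mem_range.mp hk), mul_zero]

theorem innerR_X_pow_self (hA : IsMonicOrth c n A) : innerR c A (X ^ n) = innerR c A A := by
  rw [hA.innerR_eq hA.natDegree_le, hA.coeff_eq_one, star_one, one_mul]

theorem innerR_eq_zero (hA : IsMonicOrth c n A) {ψ : ℍ[ℝ][X]} (hψ : ψ.natDegree < n) :
    innerR c A ψ = 0 := by
  rw [hA.innerR_eq hψ.le, coeff_eq_zero_of_natDegree_lt hψ, star_zero, zero_mul]

/-- `A - B` has no term in `p^n`, so it is orthogonal to both `A` and `B`, hence to itself. -/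
theorem eq (hc : IsNontrivialPosDef c) {B : ℍ[ℝ][X]} (hA : IsMonicOrth c n A)
    (hB : IsMonicOrth c n B) : A = B := by
  by_contra hne
  have hd : (A - B).natDegree ≤ n :=
    (natDegree_sub_le A B).trans (max_le hA.natDegree_le hB.natDegree_le)
  have h0 : (A - B).coeff n = 0 := by
    rw [coeff_sub, hA.coeff_eq_one, hB.coeff_eq_one, sub_self]
  have := innerR_self_re_pos hc (sub_ne_zero.mpr hne)
  rw [innerR_sub_left, hA.innerR_eq hd, hB.innerR_eq hd, h0] at this
  simp at this

/-- The pairing of the reflected monic orthogonal polynomial of `n ↦ c (-n)`. -/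
theorem innerR_reflect_X_pow {B : ℍ[ℝ][X]} (hB : IsMonicOrth (fun m => c (-m)) n B) {k : ℕ}
    (hk : k ≤ n) :
    innerR c (reflect n B) (X ^ k) = innerR (fun m => c (-m)) B (X ^ (n - k)) := by
  rw [← innerR_reflect c hB.natDegree_le ((natDegree_X_pow_le _).trans (Nat.sub_le n k)),
    reflect_monomial, revAt_le (Nat.sub_le n k), Nat.sub_sub_self hk]

/-- The numerator of the reflection coefficient. -/
theorem innerR_X_mul_reflect {B : ℍ[ℝ][X]} (hA : IsMonicOrth c n A)
    (hB : IsMonicOrth (fun m => c (-m)) n B) :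
    innerR c (X * A) (reflect n B) = innerR c (X * A) (X ^ 0) := by
  rw [innerR_eq_sum_coeff_mul c (X * A) _
      (Nat.lt_succ_of_le (natDegree_reflect_le' hB.natDegree_le)), Finset.sum_range_succ',
    Finset.sum_eq_zero, zero_add, coeff_reflect_of_le _ (Nat.zero_le n), Nat.sub_zero,
    hB.coeff_eq_one, star_one, one_mul]
  intro k hk
  rw [pow_succ', innerR_X_mul, hA.innerR_X_pow k (Finset.mem_range.mp hk), mul_zero]

/-- Reflection in degree `n + 1` sends `X * B` to `reflect n B` and `reflect n A` to `X * A`, so the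
same pair is paired in the opposite order. The two families thus have conjugate reflection
coefficients. -/
theorem innerR_X_mul_reflect_comm (hc : IsNontrivialPosDef c) {B : ℍ[ℝ][X]}
    (hA : IsMonicOrth c n A) (hB : IsMonicOrth (fun m => c (-m)) n B) :
    innerR (fun m => c (-m)) (X * B) (reflect n A) = star (innerR c (X * A) (reflect n B)) := by
  have hX : ∀ φ : ℍ[ℝ][X], φ.natDegree ≤ n → (X * φ).natDegree ≤ n + 1 := fun φ h => by
    have := natDegree_mul_le (p := X) (q := φ)
    have := natDegree_X_le (R := ℍ[ℝ])
    omega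
  rw [star_innerR hc, ← innerR_reflect c (hX B hB.natDegree_le)
    ((natDegree_reflect_le' hA.natDegree_le).trans n.le_succ), reflect_X_mul hB.natDegree_le,
    reflect_succ (natDegree_reflect_le' hA.natDegree_le), reflect_reflect]

/-- The Szegő recursion. -/
theorem succ {B : ℍ[ℝ][X]}
    (hA : IsMonicOrth c n A) (hB : IsMonicOrth (fun m => c (-m)) n B) {α : ℍ[ℝ]}
    (hα : innerR c (X * A) (reflect n B) = innerR (fun m => c (-m)) B B * α) :
    IsMonicOrth c (n + 1) (X * A - reflect n B * C α) := by
  have hd : (reflect n B * C α).natDegree ≤ n :=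
    (natDegree_mul_C_le _ _).trans (natDegree_reflect_le' hB.natDegree_le)
  refine ⟨?_, ?_, fun k hk => ?_⟩
  · refine (natDegree_sub_le _ _).trans (max_le ?_ (hd.trans n.le_succ))
    have := natDegree_mul_le (p := X) (q := A)
    have := natDegree_X_le (R := ℍ[ℝ])
    have := hA.natDegree_le
    omega
  · rw [coeff_sub, coeff_X_mul, hA.coeff_eq_one,
      coeff_eq_zero_of_natDegree_lt (Nat.lt_succ_of_le hd), sub_zero]
  · rw [innerR_sub_left, innerR_mul_C_left, hB.innerR_reflect_X_pow (Nat.lt_succ_iff.mp hk)]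
    -- The choice of `α` settles `k = 0`; for `k > 0` both terms vanish by orthogonality.
    rcases k with _ | k
    · rw [← hA.innerR_X_mul_reflect hB, hα, Nat.sub_zero, hB.innerR_X_pow_self, sub_self]
    · rw [pow_succ', innerR_X_mul, hA.innerR_X_pow k (by omega),
        hB.innerR_X_pow _ (by omega), zero_mul, sub_zero]

/-- The squared norms of consecutive monic orthogonal polynomials. -/
theorem innerR_succ (hc : IsNontrivialPosDef c) {A' B : ℍ[ℝ][X]} (hA : IsMonicOrth c n A)
    (hB : IsMonicOrth (fun m => c (-m)) n B) {α : ℍ[ℝ]}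
    (hα : innerR c (X * A) (reflect n B) = innerR (fun m => c (-m)) B B * α)
    (hA' : IsMonicOrth c (n + 1) A') :
    (innerR c A' A').re = (innerR c A A).re - (innerR (fun m => c (-m)) B B).re * ‖α‖ ^ 2 := by
  have hd : (reflect n B * C α).natDegree ≤ n :=
    (natDegree_mul_C_le _ _).trans (natDegree_reflect_le' hB.natDegree_le)
  have hr := innerR_self_eq_coe_re hc.comp_neg hB.ne_zero
  have hs := star_innerR hc (X * A) (reflect n B)
  -- The subtracted term has degree at most `n`, so `A'` is orthogonal to it.
  have h1 : innerR c A' A' = innerR c A' (X * A) := by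
    conv_lhs => rw [hA'.eq hc (hA.succ hB hα)]
    rw [innerR_sub_right, ← hA'.eq hc (hA.succ hB hα),
      hA'.innerR_eq_zero (Nat.lt_succ_of_le hd), sub_zero]
  rw [h1, hA'.eq hc (hA.succ hB hα), innerR_sub_left, innerR_X_mul, innerR_mul_C_left, ← hs,
    hα, hr, star_mul, Quaternion.star_coe, mul_assoc, Quaternion.coe_mul_eq_smul,
    mul_smul_comm, Quaternion.star_mul_self]
  simp [Quaternion.normSq_eq_norm_mul_self, sq]

end IsMonicOrth


/-! ### Gram–Schmidt -/

theorem real_smul_eq_mul_C (r : ℝ) (φ : ℍ[ℝ][X]) : r • φ = φ * C (r : ℍ[ℝ]) := by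
  ext1 k
  rw [coeff_smul, coeff_mul_C, Quaternion.mul_coe_eq_smul]

theorem innerR_smul_smul (c : ℤ → ℍ[ℝ]) (r s : ℝ) (φ ψ : ℍ[ℝ][X]) :
    innerR c (r • φ) (s • ψ) = (s * r) • innerR c φ ψ := by
  rw [real_smul_eq_mul_C, real_smul_eq_mul_C, innerR_mul_C_left, innerR_mul_C_right,
    Quaternion.star_coe, Quaternion.coe_mul_eq_smul, Quaternion.mul_coe_eq_smul, smul_smul, mul_comm]

theorem IsMonicOrth.innerR_eq_zero_of_ne {c : ℤ → ℍ[ℝ]} (hc : IsNontrivialPosDef c) {j k : ℕ}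
    {A B : ℍ[ℝ][X]} (hA : IsMonicOrth c j A) (hB : IsMonicOrth c k B) (h : j ≠ k) :
    innerR c A B = 0 := by
  rcases h.lt_or_gt with h | h
  · rw [← star_innerR hc, hB.innerR_eq_zero (hA.natDegree_le.trans_lt h), star_zero]
  · exact hA.innerR_eq_zero (hB.natDegree_le.trans_lt h)

theorem innerR_normalize_self {c : ℤ → ℍ[ℝ]} (hc : IsNontrivialPosDef c) {φ : ℍ[ℝ][X]}
    (hφ : φ ≠ 0) :
    innerR c ((Real.sqrt (innerR c φ φ).re)⁻¹ • φ) ((Real.sqrt (innerR c φ φ).re)⁻¹ • φ) = 1 := by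
  have h := innerR_self_re_pos hc hφ
  rw [innerR_smul_smul, innerR_self_eq_coe_re hc hφ, Quaternion.re_coe, ← mul_inv,
    Real.mul_self_sqrt h.le, ← Quaternion.coe_smul, smul_eq_mul, inv_mul_cancel₀ h.ne',
    Quaternion.coe_one]

/-- A polynomial orthogonal to monic orthogonal polynomials of all degrees below `n` is
orthogonal to the monomials of degree below `n`. -/
theorem innerR_X_pow_eq_zero_of_orth (c : ℤ → ℍ[ℝ]) {n : ℕ} {φ : ℍ[ℝ][X]}
    (h : ∀ k < n, ∃ A, IsMonicOrth c k A ∧ innerR c φ A = 0) (k : ℕ) (hk : k < n) :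
    innerR c φ (X ^ k) = 0 := by
  induction k using Nat.strong_induction_on with
  | _ k ih =>
    obtain ⟨A, hA, h0⟩ := h k hk
    rw [innerR_eq_sum_coeff_mul c φ A (Nat.lt_succ_of_le hA.natDegree_le),
      Finset.sum_range_succ, Finset.sum_eq_zero, zero_add, hA.coeff_eq_one, star_one,
      one_mul] at h0
    · exact h0
    · intro j hj
      have hj' := Finset.mem_range.mp hj
      rw [ih j hj' (hj'.trans hk), mul_zero]

theorem exists_isMonicOrth_psiR {c : ℤ → ℍ[ℝ]} (hc : IsNontrivialPosDef c) (n : ℕ) :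
    ∃ A, IsMonicOrth c n A ∧ psiR c n = (Real.sqrt (innerR c A A).re)⁻¹ • A := by
  induction n using Nat.strong_induction_on with
  | _ n ih =>
    choose! A hA hψ using ih
    rw [psiR]
    refine ⟨_, ?_, rfl⟩
    have hdeg : ∀ k : Fin n, ∀ a : ℍ[ℝ], (psiR c k * C a).natDegree < n := fun k a => by
      refine (natDegree_mul_C_le _ _).trans_lt ?_
      rw [hψ k k.2]
      exact ((natDegree_smul_le _ _).trans (hA k k.2).natDegree_le).trans_lt k.2
    refine ⟨?_, ?_, innerR_X_pow_eq_zero_of_orth c fun k hk => ⟨A k, hA k hk, ?_⟩⟩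
    · refine (natDegree_sub_le _ _).trans (max_le (natDegree_X_pow_le n) ?_)
      exact natDegree_sum_le_of_forall_le _ _ fun k _ => (hdeg k _).le
    · rw [coeff_sub, coeff_X_pow_self, finsetSum_coeff, Finset.sum_eq_zero, sub_zero]
      exact fun k _ => coeff_eq_zero_of_natDegree_lt (hdeg k _)
    · have hr := innerR_self_re_pos hc (hA k hk).ne_zero
      have hs : Real.sqrt (innerR c (A k) (A k)).re ≠ 0 := (Real.sqrt_pos.mpr hr).ne'
      have hAk : A k = psiR c k * C ((Real.sqrt (innerR c (A k) (A k)).re : ℝ) : ℍ[ℝ]) := by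
        rw [← real_smul_eq_mul_C, hψ k hk, smul_smul, mul_inv_cancel₀ hs, one_smul]
      rw [hAk, innerR_mul_C_right, innerR_sub_left, innerR_sum_left,
        Finset.sum_eq_single (⟨k, hk⟩ : Fin n)]
      · have h1 : innerR c (psiR c k) (psiR c k) = 1 := by
          rw [hψ k hk, innerR_normalize_self hc (hA k hk).ne_zero]
        rw [innerR_mul_C_left, h1, one_mul, sub_self, mul_zero]
      · intro j _ hj
        rw [innerR_mul_C_left, hψ j j.2, hψ k hk, innerR_smul_smul,
          (hA j j.2).innerR_eq_zero_of_ne hc (hA k hk) (fun h => hj (Fin.ext h)), smul_zero,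
          zero_mul]
      · simp

/-! ### The left polynomials -/

/-- Conjugation reverses products and replaces `c m` by `c (-m)`; passing to `c (-m)` compensates
for the latter. -/
theorem innerL_eq_star_innerR {c : ℤ → ℍ[ℝ]} (hc : IsNontrivialPosDef c)
    {φ φ' ψ ψ' : ℍ[ℝ][X]} (hφ : ∀ k, φ.coeff k = star (φ'.coeff k))
    (hψ : ∀ k, ψ.coeff k = star (ψ'.coeff k)) :
    innerL c φ ψ = star (innerR (fun m => c (-m)) φ' ψ') := by
  obtain ⟨N, h1, h2⟩ := exists_natDegree_lt₂ φ ψ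
  obtain ⟨M, h3, h4⟩ := exists_natDegree_lt₂ φ' ψ'
  rw [innerL_eq_sum_range c (h1.trans_le (le_max_left N M)) (h2.trans_le (le_max_left N M)),
    innerR_eq_sum_range _ (h3.trans_le (le_max_right N M)) (h4.trans_le (le_max_right N M))]
  simp [star_sum, star_coeff_eq hc, hφ, hψ, mul_assoc]

theorem coeff_psiL {c : ℤ → ℍ[ℝ]} (hc : IsNontrivialPosDef c) (n k : ℕ) :
    (psiL c n).coeff k = star ((psiR (fun m => c (-m)) n).coeff k) := by
  induction n using Nat.strong_induction_on generalizing k with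
  | _ n ih =>
    rw [psiL, psiR]
    have hX : ∀ k, (X ^ n : ℍ[ℝ][X]).coeff k = star ((X ^ n : ℍ[ℝ][X]).coeff k) := fun k => by
      rw [coeff_X_pow]; split_ifs <;> simp
    have hP : ∀ k, (X ^ n - ∑ j : Fin n, C (innerL c (X ^ n) (psiL c j)) * psiL c j).coeff k =
        star ((X ^ n - ∑ j : Fin n, psiR (fun m => c (-m)) j *
          C (innerR (fun m => c (-m)) (X ^ n) (psiR (fun m => c (-m)) j))).coeff k) := fun k => by
      rw [coeff_sub, coeff_sub, star_sub, ← hX, finsetSum_coeff, finsetSum_coeff, star_sum]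
      congr 1
      refine Finset.sum_congr rfl fun j _ => ?_
      rw [coeff_C_mul, coeff_mul_C, star_mul, ih j j.2,
        innerL_eq_star_innerR hc hX (fun k => ih j j.2 k)]
    rw [coeff_smul, coeff_smul, hP k, innerL_eq_star_innerR hc hP hP, Quaternion.re_star]
    ext <;> simp

theorem natDegree_eq_of_coeff_eq_star {φ φ' : ℍ[ℝ][X]} (h : ∀ k, φ.coeff k = star (φ'.coeff k)) :
    φ.natDegree = φ'.natDegree := by
  have : φ.support = φ'.support := by
    ext k
    rw [mem_support_iff, mem_support_iff, h, Ne, star_eq_zero]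
  rw [natDegree, natDegree, degree, degree, this]

theorem evalR_eq_star_evalL {φ φ' : ℍ[ℝ][X]} (h : ∀ k, φ.coeff k = star (φ'.coeff k))
    (p : ℍ[ℝ]) : evalR p φ = star (evalL (star p) φ') := by
  rw [evalR_eq_sum_range p (Nat.lt_succ_self _), evalL_eq_sum_range _ (Nat.lt_succ_self _),
    natDegree_eq_of_coeff_eq_star h, star_sum]
  simp [h]

theorem coeff_rev (φ : ℍ[ℝ][X]) (k : ℕ) :
    (rev φ).coeff k = star ((reflect φ.natDegree φ).coeff k) := by
  rw [rev, finsetSum_coeff]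
  simp only [coeff_monomial]
  rcases le_or_gt k φ.natDegree with hk | hk
  · rw [coeff_reflect_of_le _ hk, Finset.sum_eq_single (φ.natDegree - k),
      if_pos (Nat.sub_sub_self hk)]
    · intro j hj hne
      have := Finset.mem_range.mp hj
      exact if_neg (by omega)
    · intro h
      exact absurd (Finset.mem_range.mpr (by omega)) h
  · rw [coeff_eq_zero_of_natDegree_lt ((natDegree_reflect_le' le_rfl).trans_lt hk), star_zero,
      Finset.sum_eq_zero]
    intro j _
    exact if_neg (by omega)

/-- The conjugation in `rev` cancels the one relating `φ` to `φ'`. -/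
theorem rev_eq_reflect {φ φ' : ℍ[ℝ][X]} (h : ∀ k, φ.coeff k = star (φ'.coeff k)) :
    rev φ = reflect φ'.natDegree φ' := by
  ext1 k
  rw [coeff_rev, coeff_reflect, h, star_star, coeff_reflect, natDegree_eq_of_coeff_eq_star h]

/-! ### Evaluation -/

section Eval

variable (p : ℍ[ℝ]) (φ ψ : ℍ[ℝ][X])

theorem evalL_sub : evalL p (φ - ψ) = evalL p φ - evalL p ψ := by
  obtain ⟨N, h1, h2⟩ := exists_natDegree_lt₂ φ ψ
  rw [evalL_eq_sum_range p h1, evalL_eq_sum_range p h2,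
    evalL_eq_sum_range p ((natDegree_sub_le φ ψ).trans_lt (max_lt h1 h2))]
  simp [mul_sub]

theorem evalL_mul_C (a : ℍ[ℝ]) : evalL p (φ * C a) = evalL p φ * a := by
  rw [evalL_eq_sum_range p (Nat.lt_succ_self φ.natDegree),
    evalL_eq_sum_range p (Nat.lt_succ_of_le (natDegree_mul_C_le φ a))]
  simp [Finset.sum_mul, mul_assoc]

theorem evalL_X_mul : evalL p (X * φ) = p * evalL p φ := by
  have hX : (X * φ).natDegree < φ.natDegree + 1 + 1 := by
    have := natDegree_mul_le (p := X) (q := φ)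
    have := natDegree_X_le (R := ℍ[ℝ])
    omega
  rw [evalL_eq_sum_range p (Nat.lt_succ_self φ.natDegree), evalL_eq_sum_range p hX,
    Finset.sum_range_succ']
  simp [Finset.mul_sum, coeff_X_mul, pow_succ', mul_assoc]

theorem evalL_smul (r : ℝ) : evalL p (r • φ) = r • evalL p φ := by
  rw [real_smul_eq_mul_C, evalL_mul_C, Quaternion.mul_coe_eq_smul]

end Eval

/-! ### The Christoffel–Darboux identity -/

/-- The cross terms agree: both are `-2 Re (b d ā)`. -/
theorem norm_sq_sub_mul (a b d : ℍ[ℝ]) :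
    ‖b - a * star d‖ ^ 2 - ‖a - b * d‖ ^ 2 = (1 - ‖d‖ ^ 2) * (‖b‖ ^ 2 - ‖a‖ ^ 2) := by
  have hn : ∀ q : ℍ[ℝ], ‖q‖ ^ 2 = q.re ^ 2 + q.imI ^ 2 + q.imJ ^ 2 + q.imK ^ 2 := fun q => by
    rw [sq, ← Quaternion.normSq_eq_norm_mul_self, Quaternion.normSq_def']
  simp only [hn]
  simp
  ring

variable {c : ℤ → ℍ[ℝ]} {n : ℕ} {A B A' B' : ℍ[ℝ][X]}

theorem IsMonicOrth.eq_one (hA : IsMonicOrth c 0 A)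
    (hB : IsMonicOrth (fun m => c (-m)) 0 B) : A = 1 ∧ B = 1 := by
  constructor
  · rw [eq_C_of_natDegree_le_zero hA.natDegree_le, hA.coeff_eq_one, C_1]
  · rw [eq_C_of_natDegree_le_zero hB.natDegree_le, hB.coeff_eq_one, C_1]

/-- The Szegő recursion at a point, with equal norms of the two families. -/
theorem IsMonicOrth.exists_szego (hc : IsNontrivialPosDef c) (hA : IsMonicOrth c n A)
    (hB : IsMonicOrth (fun m => c (-m)) n B)
    (hN : (innerR (fun m => c (-m)) B B).re = (innerR c A A).re)
    (hA' : IsMonicOrth c (n + 1) A') (hB' : IsMonicOrth (fun m => c (-m)) (n + 1) B') :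
    ∃ α : ℍ[ℝ], A' = X * A - reflect n B * C α ∧
      reflect (n + 1) B' = reflect n B - X * A * C (star α) ∧
      (innerR c A' A').re = (1 - ‖α‖ ^ 2) * (innerR c A A).re ∧
      (innerR (fun m => c (-m)) B' B').re = (innerR c A' A').re := by
  -- The roles of `A` and `B` are symmetric, since negating the index twice restores `c`.
  have hA2 : IsMonicOrth (fun m => (fun m => c (-m)) (-m)) n A := by simpa using hA
  have hpos := innerR_self_re_pos hc hA.ne_zero
  set N := (innerR c A A).re with hNdef
  have hNB : innerR (fun m => c (-m)) B B = (N : ℍ[ℝ]) := by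
    rw [innerR_self_eq_coe_re hc.comp_neg hB.ne_zero, hN]
  have hNA : innerR c A A = (N : ℍ[ℝ]) := innerR_self_eq_coe_re hc hA.ne_zero
  obtain ⟨α, hα⟩ : ∃ α, innerR c (X * A) (reflect n B) = N * α :=
    ⟨N⁻¹ • innerR c (X * A) (reflect n B), by
      rw [Quaternion.coe_mul_eq_smul, smul_smul, mul_inv_cancel₀ hpos.ne', one_smul]⟩
  have hβ : innerR (fun m => c (-m)) (X * B) (reflect n A) =
      innerR (fun m => (fun m => c (-m)) (-m)) A A * star α := by
    rw [hA.innerR_X_mul_reflect_comm hc hB, hα, star_mul, Quaternion.star_coe]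
    simp only [neg_neg]
    rw [hNA, Quaternion.coe_mul_eq_smul, Quaternion.mul_coe_eq_smul]
  rw [← hNB] at hα
  have e1 := hA.innerR_succ hc hB hα hA'
  have e2 := hB.innerR_succ hc.comp_neg hA2 hβ hB'
  simp only [neg_neg] at e2
  refine ⟨α, hA'.eq hc (hA.succ hB hα), ?_, ?_, ?_⟩
  · rw [hB'.eq hc.comp_neg (hB.succ hA2 hβ), reflect_sub', reflect_X_mul hB.natDegree_le,
      reflect_mul_C, reflect_succ (natDegree_reflect_le' hA.natDegree_le), reflect_reflect]
  · rw [e1, hN]; ring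
  · rw [e1, e2, hN, norm_star]

theorem IsMonicOrth.innerR_self_eq (hc : IsNontrivialPosDef c) (hA : IsMonicOrth c n A)
    (hB : IsMonicOrth (fun m => c (-m)) n B) :
    (innerR (fun m => c (-m)) B B).re = (innerR c A A).re := by
  induction n generalizing A B with
  | zero =>
    obtain ⟨rfl, rfl⟩ := hA.eq_one hB
    rw [innerR_eq_sum_range (N := 1) _ (by simp) (by simp),
      innerR_eq_sum_range (N := 1) _ (by simp) (by simp)]
    simp
  | succ n ih =>
    obtain ⟨A₀, hA₀, -⟩ := exists_isMonicOrth_psiR hc n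
    obtain ⟨B₀, hB₀, -⟩ := exists_isMonicOrth_psiR hc.comp_neg n
    obtain ⟨-, -, -, -, h⟩ := hA₀.exists_szego hc hB₀ (ih hA₀ hB₀) hA hB
    exact h

theorem christoffelDarboux_step (hc : IsNontrivialPosDef c) (p : ℍ[ℝ]) (n : ℕ) :
    ‖evalL p (reflect (n + 1) (psiR (fun m => c (-m)) (n + 1)))‖ ^ 2 -
        ‖evalL p (psiR c (n + 1))‖ ^ 2 =
      ‖evalL p (reflect n (psiR (fun m => c (-m)) n))‖ ^ 2 -
        ‖p‖ ^ 2 * ‖evalL p (psiR c n)‖ ^ 2 := by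
  obtain ⟨A, hA, hψA⟩ := exists_isMonicOrth_psiR hc n
  obtain ⟨B, hB, hψB⟩ := exists_isMonicOrth_psiR hc.comp_neg n
  obtain ⟨A', hA', hψA'⟩ := exists_isMonicOrth_psiR hc (n + 1)
  obtain ⟨B', hB', hψB'⟩ := exists_isMonicOrth_psiR hc.comp_neg (n + 1)
  obtain ⟨α, eA, eB, eN, eN'⟩ := hA.exists_szego hc hB (hA.innerR_self_eq hc hB) hA' hB'
  have hpos := innerR_self_re_pos hc hA.ne_zero
  have hpos' := innerR_self_re_pos hc hA'.ne_zero
  have hnorm : ∀ (r : ℝ), 0 < r → ∀ q : ℍ[ℝ], ‖(Real.sqrt r)⁻¹ • q‖ ^ 2 = ‖q‖ ^ 2 / r :=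
    fun r hr q => by
      rw [norm_smul, norm_inv, Real.norm_eq_abs, mul_pow, inv_pow, sq_abs, Real.sq_sqrt hr.le]
      field_simp
  have hrefl : ∀ (N : ℕ) (r : ℝ) (φ : ℍ[ℝ][X]), reflect N (r • φ) = r • reflect N φ :=
    fun N r φ => by rw [real_smul_eq_mul_C, reflect_mul_C, ← real_smul_eq_mul_C]
  rw [hψA, hψB, hψA', hψB', eN', hA.innerR_self_eq hc hB]
  simp only [hrefl, evalL_smul, hnorm _ hpos, hnorm _ hpos']
  have key := norm_sq_sub_mul (p * evalL p A) (evalL p (reflect n B)) α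
  rw [← evalL_X_mul, ← evalL_mul_C, ← evalL_mul_C, ← evalL_sub, ← evalL_sub, ← eA, ← eB,
    evalL_X_mul, norm_mul, mul_pow] at key
  rw [← sub_div, key, eN]
  rw [eN] at hpos'
  -- Both squared norms are positive, so `1 - ‖α‖ ^ 2` is positive and cancels.
  have := (pos_of_mul_pos_left hpos' hpos.le).ne'
  field_simp

theorem christoffelDarboux_half (hc : IsNontrivialPosDef c) (p : ℍ[ℝ]) (n : ℕ) :
    (∑ l ∈ Finset.range (n + 1), ‖evalL p (psiR c l)‖ ^ 2) * (1 - ‖p‖ ^ 2) =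
      ‖evalL p (reflect n (psiR (fun m => c (-m)) n))‖ ^ 2 -
        ‖p‖ ^ 2 * ‖evalL p (psiR c n)‖ ^ 2 := by
  induction n with
  | zero =>
    obtain ⟨A, hA, hψA⟩ := exists_isMonicOrth_psiR hc 0
    obtain ⟨B, hB, hψB⟩ := exists_isMonicOrth_psiR hc.comp_neg 0
    have h : psiR (fun m => c (-m)) 0 = psiR c 0 := by
      rw [hψA, hψB, hA.innerR_self_eq hc hB, (hA.eq_one hB).1,
        (hA.eq_one hB).2]
    have h' : reflect 0 (psiR c 0) = psiR c 0 := by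
      rw [hψA, (hA.eq_one hB).1, real_smul_eq_mul_C, one_mul, reflect_C, pow_zero,
        mul_one]
    rw [h, h']
    simp
    ring
  | succ n ih =>
    -- The step trades the degree-`n` right side for the difference in degree `n + 1`; the new
    -- summand turns its coefficient `-1` into `-‖p‖ ^ 2`.
    rw [Finset.sum_range_succ, add_mul, ih, ← christoffelDarboux_step hc p n]
    ring

end QuatOP

open QuatOP in
theorem mainTheorem8 (c : ℤ → ℍ[ℝ]) (hc : QuatOP.IsNontrivialPosDef c) (n : ℕ)
    (p : ℍ[ℝ]) (hp : ‖p‖ ≠ 1) :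
    (∑ l ∈ Finset.range (n + 1),
        (‖QuatOP.evalR p (QuatOP.psiL c l)‖ ^ 2 + ‖QuatOP.evalL p (QuatOP.psiR c l)‖ ^ 2) =
      (‖QuatOP.evalL p (QuatOP.rev (QuatOP.psiL c (n + 1)))‖ ^ 2 +
          ‖QuatOP.evalR p (QuatOP.rev (QuatOP.psiR c (n + 1)))‖ ^ 2 -
        (‖QuatOP.evalR p (QuatOP.psiL c (n + 1))‖ ^ 2 +
          ‖QuatOP.evalL p (QuatOP.psiR c (n + 1))‖ ^ 2)) / (1 - ‖p‖ ^ 2)) ∧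
    (∑ l ∈ Finset.range (n + 1),
        (‖QuatOP.evalR p (QuatOP.psiL c l)‖ ^ 2 + ‖QuatOP.evalL p (QuatOP.psiR c l)‖ ^ 2) =
      (‖QuatOP.evalL p (QuatOP.rev (QuatOP.psiL c n))‖ ^ 2 +
          ‖QuatOP.evalR p (QuatOP.rev (QuatOP.psiR c n))‖ ^ 2 -
        ‖p‖ ^ 2 * (‖QuatOP.evalR p (QuatOP.psiL c n)‖ ^ 2 +
          ‖QuatOP.evalL p (QuatOP.psiR c n)‖ ^ 2)) / (1 - ‖p‖ ^ 2)) := by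
  have hp' : 1 - ‖p‖ ^ 2 ≠ 0 := fun h => hp <| by
    have : ‖p‖ ^ 2 = 1 := by linarith
    exact (pow_eq_one_iff_of_nonneg (norm_nonneg p) two_ne_zero).mp this
  have hdeg : ∀ {c : ℤ → ℍ[ℝ]}, IsNontrivialPosDef c → ∀ m, (psiR c m).natDegree = m := by
    intro c hc m
    obtain ⟨A, hA, hψ⟩ := exists_isMonicOrth_psiR hc m
    have hs := (Real.sqrt_pos.mpr (innerR_self_re_pos hc hA.ne_zero)).ne'
    rw [hψ, Polynomial.natDegree_smul _ (inv_ne_zero hs), hA.natDegree_eq]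
  have hL : ∀ m, ‖evalR p (psiL c m)‖ = ‖evalL (star p) (psiR (fun m => c (-m)) m)‖ := fun m => by
    rw [evalR_eq_star_evalL (coeff_psiL hc m), norm_star]
  have hrL : ∀ m, ‖evalL p (rev (psiL c m))‖ =
      ‖evalL p (Polynomial.reflect m (psiR (fun m => c (-m)) m))‖ := fun m => by
    rw [rev_eq_reflect (coeff_psiL hc m), hdeg hc.comp_neg]
  have hrR : ∀ m, ‖evalR p (rev (psiR c m))‖ =
      ‖evalL (star p) (Polynomial.reflect m (psiR c m))‖ := fun m => by
    rw [evalR_eq_star_evalL (coeff_rev _), norm_star, hdeg hc]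
  -- The half for `c` at `p` gives the sum over `psiR`; that for `c (-m)` at `star p` gives the sum
  -- over `psiL`.
  have h1 := christoffelDarboux_half hc p n
  have h2 := christoffelDarboux_half hc.comp_neg (star p) n
  have s1 := christoffelDarboux_step hc p n
  have s2 := christoffelDarboux_step hc.comp_neg (star p) n
  simp only [neg_neg, norm_star] at h2 s2
  simp only [hL, hrL, hrR, Finset.sum_add_distrib, eq_div_iff hp', add_mul, h1, h2]
  constructor <;> linarith
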